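/- All rings are commutative with unit. Let $R$ be a ring and let $E$ be an almost finitely generated $R$-module, i.e. there are a ring $A$, a ring morphism $R\to A$ and an $A$-module structure on the additive group of $E$ that induces the given $R$-module structure on $E$ and makes $E$ a finitely generated $A$-module. Let $f:R\to S$ be a generizing (going-down) ring morphism, i.e. for all prime ideals $P'\subseteq P$ of $R$ and every prime ideal $Q$ of $S$ with $f^{-1}(Q)=P$ there is a prime ideal $Q'\subseteq Q$ of $S$ with $f^{-1}(Q')=P'$. For a ring $B$ and a $B$-module $M$ let $\mathrm{Supp}_B(M)=\{P\in\mathrm{Spec}(B)\mid M_P\neq 0\}$, and let ${}^af:\mathrm{Spec}(S)\to\mathrm{Spec}(R)$, $Q\mapsto f^{-1}(Q)$, be the map induced by $f$. Then $${}^af^{-1}(\mathrm{Supp}_R(E))=\mathrm{Supp}_S(E\otimes_RS).$$ -/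

import Mathlib

open scoped TensorProduct

universe w u v t

/-- An `R`-module `E` is almost finitely generated if there are a commutative ring `A` (in some
universe `w`), a ring morphism `g : R → A` and an `A`-module structure on the additive group `E`
which induces on `E` the original `R`-module structure and for which `E` is a finitely generated
`A`-module. -/
def AlmostFinitelyGenerated (R : Type u) (E : Type v)
    [CommRing R] [AddCommGroup E] [Module R E] : Prop :=
  ∃ (A : Type w) (_ : CommRing A) (g : R →+* A) (_ : Module A E),
    (∀ (r : R) (x : E), g r • x = r • x) ∧ Module.Finite A E

/-! Only `⊆` needs the hypotheses. If `Q` lies over a prime of `Supp_R E`, that prime contains the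
contraction `p` of some `q ∈ Supp_A E`. Going down gives `Q' ⊆ Q` over `p`, and supports are closed
under specialization, so `Q'` suffices. By Nakayama over `A`, `κ(q) ⊗[A] E` is nonzero; it is a
`κ(p)`-vector space, hence stays nonzero over `κ(Q')`, and this detects `S ⊗[R] E` at `Q'`. -/

/-- Over a field `K`, a nonzero vector stays nonzero after base change to a nontrivial
`K`-algebra. -/
theorem one_tmul_ne_zero_of_ne_zero {K L V : Type*} [Field K] [CommRing L] [Nontrivial L]
    [Algebra K L] [AddCommGroup V] [Module K V] {x : V} (hx : x ≠ 0) :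
    (1 : L) ⊗ₜ[K] x ≠ 0 := by
  intro h
  exact hx (Module.FaithfullyFlat.tensorProduct_mk_injective (A := K) (B := L) V
    (by simpa using h))

/-- Every prime in the support of `E` over `R` contains the contraction of a prime in the support
of `E` over `A`, if `A` is an `R`-algebra acting compatibly on `E`. -/
theorem Module.exists_mem_support_comap_le {R A E : Type*} [CommRing R] [CommRing A] [Algebra R A]
    [AddCommGroup E] [Module R E] [Module A E] [IsScalarTower R A E] {p : PrimeSpectrum R}
    (hp : p ∈ Module.support R E) :
    ∃ q ∈ Module.support A E, PrimeSpectrum.comap (algebraMap R A) q ≤ p := by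
  obtain ⟨x, hx⟩ := Module.mem_support_iff'.mp hp
  -- No element outside `p` kills `x`, so the annihilator of `x` in `A` misses the image of that
  -- complement.
  obtain ⟨q, hq, hle, hdisj⟩ := Ideal.exists_le_prime_disjoint
    (Submodule.span A {x}).annihilator (p.asIdeal.primeCompl.map (algebraMap R A)) <| by
      rw [Set.disjoint_left]
      rintro _ ha ⟨r, hr, rfl⟩
      rw [SetLike.mem_coe, Submodule.mem_annihilator_span_singleton] at ha
      exact hx r hr (by simpa using ha)
  refine ⟨⟨q, hq⟩, Module.mem_support_iff_exists_annihilator.mpr ⟨x, hle⟩, fun r hr ↦ ?_⟩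
  by_contra hrp
  exact Set.disjoint_left.mp hdisj hr ⟨r, hrp, rfl⟩

/-- Let `E` be a finite `A`-module over an `R`-algebra `A`. If a prime of `S` and a prime of `A`
in the support of `E` have the same contraction to `R`, then the former is in the support of the
base change `S ⊗[R] E`. -/
theorem Module.mem_support_tensorProduct_of_comap_eq {R S A E : Type*} [CommRing R] [CommRing S]
    [CommRing A] [Algebra R S] [Algebra R A] [AddCommGroup E] [Module R E] [Module A E]
    [IsScalarTower R A E] [Module.Finite A E] {q : PrimeSpectrum A} {Q : PrimeSpectrum S}
    (hq : q ∈ Module.support A E)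
    (h : PrimeSpectrum.comap (algebraMap R A) q = PrimeSpectrum.comap (algebraMap R S) Q) :
    Q ∈ Module.support S (S ⊗[R] E) := by
  obtain ⟨p, hpq⟩ : ∃ p, p = PrimeSpectrum.comap (algebraMap R A) q := ⟨_, rfl⟩
  have hpQ : p = PrimeSpectrum.comap (algebraMap R S) Q := hpq.trans h
  let K := p.asIdeal.ResidueField
  let L := Q.asIdeal.ResidueField
  let F := q.asIdeal.ResidueField
  let φF : K →+* F := Ideal.ResidueField.map p.asIdeal q.asIdeal (algebraMap R A) (by simp [hpq])
  let φL : K →+* L := Ideal.ResidueField.map p.asIdeal Q.asIdeal (algebraMap R S) (by simp [hpQ])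
  let _ : Algebra K F := φF.toAlgebra
  let _ : Algebra K L := φL.toAlgebra
  have : IsScalarTower R K F := .of_algebraMap_eq fun r ↦ by
    rw [IsScalarTower.algebraMap_apply R A F]
    exact (Ideal.ResidueField.map_algebraMap _ _ _ _ r).symm
  have : IsScalarTower R K L := .of_algebraMap_eq fun r ↦ by
    rw [IsScalarTower.algebraMap_apply R S L]
    exact (Ideal.ResidueField.map_algebraMap _ _ _ _ r).symm
  -- Nakayama: finiteness over `A` enters here.
  have : Nontrivial (F ⊗[A] E) :=
    Module.mem_support_iff_nontrivial_residueField_tensorProduct q |>.mp hq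
  obtain ⟨x, hx⟩ : ∃ x : E, (1 : F) ⊗ₜ[A] x ≠ 0 := by
    by_contra! hx
    obtain ⟨y, hy⟩ := exists_ne (0 : F ⊗[A] E)
    refine hy (y.induction_on rfl (fun a x ↦ ?_) fun a b ha hb ↦ by rw [ha, hb, add_zero])
    simpa [TensorProduct.smul_tmul'] using congr(a • $(hx x))
  refine Module.mem_support_iff'.mpr ⟨1 ⊗ₜ x, fun s hs hsx ↦ ?_⟩
  have hs0 : algebraMap S L s ≠ 0 := by simpa [L] using hs
  -- A relation `s • (1 ⊗ x) = 0` with `s ∉ Q` is pushed to residue fields, where `s` becomes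
  -- invertible.
  let f : S ⊗[R] E →ₗ[R] L ⊗[R] (F ⊗[A] E) :=
    TensorProduct.map (IsScalarTower.toAlgHom R S L).toLinearMap
      ((TensorProduct.mk A F E 1).restrictScalars R)
  have hzero : algebraMap S L s ⊗ₜ[K] ((1 : F) ⊗ₜ[A] x) = 0 := by
    have := congr(TensorProduct.mapOfCompatibleSMul K R R L (F ⊗[A] E) (f $hsx))
    simpa [f, TensorProduct.smul_tmul'] using this
  refine one_tmul_ne_zero_of_ne_zero (K := K) (L := L) hx ?_
  have := congr((algebraMap S L s)⁻¹ • $hzero)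
  rwa [TensorProduct.smul_tmul', smul_eq_mul, inv_mul_cancel₀ hs0, smul_zero] at this

/-- The support of a base change lies over the support of the module. -/
theorem Module.comap_mem_support_of_mem_support_tensorProduct {R S E : Type*} [CommRing R]
    [CommRing S] [Algebra R S] [AddCommGroup E] [Module R E] {Q : PrimeSpectrum S}
    (hQ : Q ∈ Module.support S (S ⊗[R] E)) :
    PrimeSpectrum.comap (algebraMap R S) Q ∈ Module.support R E := by
  by_contra hP
  rw [Module.notMem_support_iff'] at hP
  refine Module.notMem_support_iff'.mpr (fun y ↦ ?_) hQ
  induction y with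
  | zero => exact ⟨1, Q.asIdeal.primeCompl.one_mem, smul_zero _⟩
  | tmul s x =>
    obtain ⟨r, hr, hrx⟩ := hP x
    exact ⟨algebraMap R S r, hr, by rw [algebraMap_smul, ← TensorProduct.tmul_smul, hrx,
      TensorProduct.tmul_zero]⟩
  | add a b ha hb =>
    obtain ⟨r, hr, hra⟩ := ha
    obtain ⟨t, ht, htb⟩ := hb
    refine ⟨r * t, Q.asIdeal.primeCompl.mul_mem hr ht, ?_⟩
    rw [smul_add, mul_comm, mul_smul, hra, mul_comm, mul_smul, htb, smul_zero, smul_zero, add_zero]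

theorem mainTheorem6 {R : Type u} {S : Type v} {E : Type t}
    [CommRing R] [CommRing S] [Algebra R S] [AddCommGroup E] [Module R E]
    (hE : AlmostFinitelyGenerated.{w} R E) (hf : Algebra.HasGoingDown R S) :
    PrimeSpectrum.comap (algebraMap R S) ⁻¹' Module.support R E =
      Module.support S (S ⊗[R] E) := by
  obtain ⟨A, _, g, _, hg, _⟩ := hE
  let _ : Algebra R A := g.toAlgebra
  have : IsScalarTower R A E := .of_algebraMap_smul hg
  refine Set.Subset.antisymm (fun Q hQ ↦ ?_) fun Q hQ ↦
    Module.comap_mem_support_of_mem_support_tensorProduct hQ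
  obtain ⟨q, hq, hle⟩ := Module.exists_mem_support_comap_le (A := A) hQ
  have : Q.asIdeal.LiesOver (PrimeSpectrum.comap (algebraMap R S) Q).asIdeal := ⟨rfl⟩
  obtain ⟨Q', hQ', hprime, hover⟩ := Ideal.exists_ideal_le_liesOver_of_le Q.asIdeal hle
  refine Module.mem_support_mono (p := ⟨Q', hprime⟩) hQ' ?_
  exact Module.mem_support_tensorProduct_of_comap_eq hq (PrimeSpectrum.ext hover.over)
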